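/- Work over $\mathbb{C}$ and let $n\ge 0$. Write points of $\mathbb{P}^{n+1}$ as $p=[p_0:\dots:p_n:p_s]$. Let $X\subseteq\mathbb{P}^{n+1}$ be an algebraic statistical model, i.e. a (not necessarily irreducible) projective variety contained in the hyperplane $p_0+\dots+p_n-p_s=0$. Let $X_{reg}$ be its set of nonsingular points (the points $p\in X$ at which the dimension of the tangent space $T_pX$ equals the local dimension of $X$ at $p$), let $X_{sing}=X\setminus X_{reg}$, and let $\mathcal H=\{p_0\cdots p_np_s=0\}$. All closures below are Zariski closures in products of copies of $\mathbb{P}^{n+1}$. - The conormal variety is $\mathcal N_X=\overline{\{(p,b): p\in X_{reg},\ b\perp T_pX\}}\subseteq\mathbb{P}^{n+1}\times\mathbb{P}^{n+1}$, where $b\perp T_pX$ means that $\sum_i b_iv_i=0$ for all $v$ in the linear subspace of $\mathbb{C}^{n+2}$ underlying $T_pX$. The dual variety $X^*$ is the projection of $\mathcal N_X$ to the $b$-coordinates. - The extended likelihood correspondence is $$\mathcal E_X=\overline{\{(p,b,u): (p,b)\in\mathcal N_X,\ [p_0b_0:\dots:p_nb_n:p_sb_s]=[u_0:\dots:u_n:u_s]\}}\subseteq(\mathbb{P}^{n+1})^3,$$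 where the equality includes the condition that $p_0b_0,\dots,p_nb_n,p_sb_s$ are not all zero. - The ML data singular locus is $\mathrm{DS}(X)=\pi_u\big(\pi_p^{-1}(X_{sing}\setminus\mathcal H)\cap\mathcal E_X\big)$, where $\pi_p,\pi_u$ are the projections of $(\mathbb{P}^{n+1})^3$ to the $p$- and $u$-coordinates. - For $A,B\subseteq\mathbb{P}^{n+1}$, the Hadamard product $A*B$ with respect to the hypersurface $p_0b_0+\dots+p_nb_n+p_sb_s=0$ is the set of all points $[p_0b_0:\dots:p_nb_n:p_sb_s]$ with $p\in A$, $b\in B$, $p_0b_0+\dots+p_nb_n+p_sb_s=0$ and $p_0b_0,\dots,p_nb_n,p_sb_s$ not all zero. Then $$(X_{sing}\setminus\mathcal H)*\{[1:\dots:1:-1]\}\ \subseteq\ \mathrm{DS}(X)\ \subseteq\ (X_{sing}\setminus\mathcal H)*X^*.$$ -/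

import Mathlib

open scoped LinearAlgebra.Projectivization

namespace MLDataSingular

noncomputable section

/-- Complex projective space `ℙ^{n+1}`, with homogeneous coordinates indexed by `Fin (n + 2)`:
the indices `0, …, n` are the coordinates `p_0, …, p_n`, and the last index is the homogenizing
coordinate `p_s`. -/
abbrev PSpace (n : ℕ) : Type := ℙ ℂ (Fin (n + 2) → ℂ)

/-- Polynomials in the homogeneous coordinates of `ℙ^{n+1}`. -/
abbrev CoordPoly (n : ℕ) : Type := MvPolynomial (Fin (n + 2)) ℂ

/-- Vanishing of `f` at a point of projective space. It is used for homogeneous `f` only, where it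
does not depend on the representative. -/
def Vanishes {n : ℕ} (f : CoordPoly n) (p : PSpace n) : Prop :=
  MvPolynomial.eval p.rep f = 0

/-- Zariski closed subsets of `ℙ^{n+1}`: common zero sets of homogeneous polynomials.
They need not be irreducible. -/
def IsProjectiveVariety {n : ℕ} (X : Set (PSpace n)) : Prop :=
  ∃ S : Set (CoordPoly n), (∀ f ∈ S, ∃ d, f.IsHomogeneous d) ∧ X = {p | ∀ f ∈ S, Vanishes f p}

/-- An algebraic statistical model: a projective variety inside the hyperplane
`p_0 + ⋯ + p_n - p_s = 0`. -/
structure IsAlgebraicStatisticalModel {n : ℕ} (X : Set (PSpace n)) : Prop where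
  isProjectiveVariety : IsProjectiveVariety X
  mem_hyperplane : ∀ p ∈ X, ∑ i : Fin (n + 1), p.rep i.castSucc - p.rep (Fin.last (n + 1)) = 0

/-! ### Dimension, tangent spaces, regular and singular points -/

/-- The homogeneous polynomials that vanish on `X`. -/
def homogeneousVanishing {n : ℕ} (X : Set (PSpace n)) : Set (CoordPoly n) :=
  {f | (∃ d, f.IsHomogeneous d) ∧ ∀ p ∈ X, Vanishes f p}

/-- The homogeneous (radical) ideal of `X`. -/
def projVanishingIdeal {n : ℕ} (X : Set (PSpace n)) : Ideal (CoordPoly n) :=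
  Ideal.span (homogeneousVanishing X)

/-- Irreducible projective varieties. -/
def IsIrreducibleVariety {n : ℕ} (Z : Set (PSpace n)) : Prop :=
  IsProjectiveVariety Z ∧ Z.Nonempty ∧
    ∀ A B : Set (PSpace n), IsProjectiveVariety A → IsProjectiveVariety B →
      Z ⊆ A ∪ B → Z ⊆ A ∨ Z ⊆ B

/-- The dimension of the affine cone over `Z`, i.e. the Krull dimension of the homogeneous
coordinate ring of `Z`. For a nonempty variety `Z` this is `dim Z + 1`. -/
def coneDim {n : ℕ} (Z : Set (PSpace n)) : WithBot ℕ∞ :=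
  ringKrullDim (CoordPoly n ⧸ projVanishingIdeal Z)

/-- The local dimension at `p` of the affine cone over `X` (one more than the local dimension of
`X` at `p`): the largest dimension of the cone over an irreducible variety `Z` with
`p ∈ Z ⊆ X`, equivalently over an irreducible component of `X` through `p`. If `X` is irreducible
and contains `p`, this is `dim X + 1`. -/
def localConeDim {n : ℕ} (X : Set (PSpace n)) (p : PSpace n) : WithBot ℕ∞ :=
  ⨆ (Z : Set (PSpace n)) (_ : IsIrreducibleVariety Z ∧ p ∈ Z ∧ Z ⊆ X), coneDim Z

/-- The tangent space `T_p X`, as a linear subspace of `ℂ^{n+2}` (the tangent space of the affine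
cone): the kernel of the Jacobian matrix at `p` of all homogeneous polynomials vanishing
on `X`. -/
def tangentSpace {n : ℕ} (X : Set (PSpace n)) (p : PSpace n) :
    Submodule ℂ (Fin (n + 2) → ℂ) where
  carrier := {v | ∀ f ∈ homogeneousVanishing X,
    ∑ i, MvPolynomial.eval p.rep (MvPolynomial.pderiv i f) * v i = 0}
  add_mem' := by
    intro v w hv hw f hf
    simp only [Pi.add_apply, mul_add, Finset.sum_add_distrib]
    rw [hv f hf, hw f hf, add_zero]
  zero_mem' := by
    intro f _
    simp
  smul_mem' := by
    intro c v hv f hf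
    have h := hv f hf
    calc ∑ i, MvPolynomial.eval p.rep (MvPolynomial.pderiv i f) * (c • v) i
        = c * ∑ i, MvPolynomial.eval p.rep (MvPolynomial.pderiv i f) * v i := by
          rw [Finset.mul_sum]
          exact Finset.sum_congr rfl fun i _ => by simp only [Pi.smul_apply, smul_eq_mul]; ring
      _ = 0 := by rw [h, mul_zero]

/-- The regular locus of `X`: the points where the dimension of the tangent space equals the local
dimension of `X` (Jacobian criterion). -/
def regularLocus {n : ℕ} (X : Set (PSpace n)) : Set (PSpace n) :=
  {p | p ∈ X ∧ (Module.finrank ℂ (tangentSpace X p) : WithBot ℕ∞) = localConeDim X p}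

/-- The singular locus of `X`. -/
def singularLocus {n : ℕ} (X : Set (PSpace n)) : Set (PSpace n) :=
  X \ regularLocus X

/-- The union `𝓗` of the coordinate hyperplanes, `p_0 ⋯ p_n p_s = 0`. -/
def coordHyperplanes (n : ℕ) : Set (PSpace n) :=
  {p | ∏ i, p.rep i = 0}

/-! ### Zariski closure in products of projective spaces -/

/-- Polynomials in `k` groups of variables that are homogeneous in each group separately. -/
def IsMultihomogeneous {n k : ℕ} (F : MvPolynomial (Fin k × Fin (n + 2)) ℂ) : Prop :=
  ∃ d : Fin k → ℕ, ∀ m ∈ F.support, ∀ j, ∑ i, m (j, i) = d j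

/-- Vanishing of `F` at a point of the `k`-fold product of `ℙ^{n+1}`. It is used for
multihomogeneous `F` only, where it does not depend on the representatives. -/
def MultiVanishes {n k : ℕ} (F : MvPolynomial (Fin k × Fin (n + 2)) ℂ)
    (x : Fin k → PSpace n) : Prop :=
  MvPolynomial.eval (fun ji : Fin k × Fin (n + 2) => (x ji.1).rep ji.2) F = 0

/-- The Zariski closure in the `k`-fold product `ℙ^{n+1} × ⋯ × ℙ^{n+1}`: the common zeros of all
multihomogeneous polynomials that vanish on the set. -/
def zariskiClosure {n k : ℕ} (S : Set (Fin k → PSpace n)) : Set (Fin k → PSpace n) :=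
  {x | ∀ F : MvPolynomial (Fin k × Fin (n + 2)) ℂ, IsMultihomogeneous F →
    (∀ y ∈ S, MultiVanishes F y) → MultiVanishes F x}

/-! ### Conormal variety, dual variety, Hadamard product -/

/-- The conormal variety `𝓝_X ⊆ ℙ^{n+1} × ℙ^{n+1}`: the closure of the set of pairs `(p, b)` with
`p` a regular point of `X` and `b ⊥ T_p X`. -/
def conormalVariety {n : ℕ} (X : Set (PSpace n)) : Set (Fin 2 → PSpace n) :=
  zariskiClosure {x | x 0 ∈ regularLocus X ∧
    ∀ v ∈ tangentSpace X (x 0), ∑ i, (x 1).rep i * v i = 0}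

/-- The dual variety `X^*`, the projection of the conormal variety to the second factor. -/
def dualVariety {n : ℕ} (X : Set (PSpace n)) : Set (PSpace n) :=
  (fun x => x 1) '' conormalVariety X

/-- `[p_0 b_0 : ⋯ : p_n b_n : p_s b_s]` is defined (its entries do not all vanish) and equals
`u`. -/
def IsCoordProduct {n : ℕ} (p b u : PSpace n) : Prop :=
  ∃ h : (fun i => p.rep i * b.rep i) ≠ 0, Projectivization.mk ℂ (fun i => p.rep i * b.rep i) h = u

/-- The Hadamard product of `A` and `B` with respect to the hypersurface
`p_0 b_0 + ⋯ + p_n b_n + p_s b_s = 0`: the image of the part of `A × B` that lies on this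
hypersurface under the (partially defined) coordinatewise multiplication. -/
def hadamardProduct {n : ℕ} (A B : Set (PSpace n)) : Set (PSpace n) :=
  {u | ∃ p ∈ A, ∃ b ∈ B, ∑ i, p.rep i * b.rep i = 0 ∧ IsCoordProduct p b u}

/-! ### Extended likelihood correspondence and data singular locus -/

/-- The extended likelihood correspondence `𝓔_X ⊆ ℙ^{n+1} × ℙ^{n+1} × ℙ^{n+1}`: the closure of the
set of triples `(p, b, u)` with `(p, b) ∈ 𝓝_X` and `[p_0 b_0 : ⋯ : p_s b_s] = u`. -/
def extendedLikelihoodCorrespondence {n : ℕ} (X : Set (PSpace n)) : Set (Fin 3 → PSpace n) :=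
  zariskiClosure {x | ![x 0, x 1] ∈ conormalVariety X ∧ IsCoordProduct (x 0) (x 1) (x 2)}

/-- The ML data singular locus `DS(X) = π_u(π_p⁻¹(X_sing \ 𝓗) ∩ 𝓔_X)`. -/
def dataSingularLocus {n : ℕ} (X : Set (PSpace n)) : Set (PSpace n) :=
  (fun x => x 2) '' ((fun x => x 0) ⁻¹' (singularLocus X \ coordHyperplanes n) ∩
    extendedLikelihoodCorrespondence X)

/-- The vector `(1, …, 1, -1)`. -/
def onesVec (n : ℕ) : Fin (n + 2) → ℂ :=
  Fin.snoc (fun _ : Fin (n + 1) => (1 : ℂ)) (-1)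

theorem onesVec_ne_zero (n : ℕ) : onesVec n ≠ 0 := by
  intro h
  have h1 := congrFun h (Fin.last (n + 1))
  simp [onesVec] at h1

/-- The point `[1 : ⋯ : 1 : -1]`. -/
def onesPoint (n : ℕ) : PSpace n :=
  Projectivization.mk ℂ (onesVec n) (onesVec_ne_zero n)

end

end MLDataSingular

/-! The key fact is that regular points are dense in X (`exists_mem_regularLocus`). The hyperplane
equation makes (1,…,1,-1) orthogonal to every tangent space, so each regular q paired with
[1:…:1:-1] is conormal. By density the same holds for every p in X
(`mem_conormalVariety_onesPoint`), which gives the first inclusion. For the second, membership of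
(p,b) in 𝓝_X and the equations p_i b_i u_j = p_j b_j u_i are closed conditions, so they pass to 𝓔_X.
Euler's identity gives ∑ p_i b_i = 0 on 𝓝_X, and off 𝓗 the equations force u = p*b. Density: a
nonempty open part of X contains an irreducible one, X ∩ {g ≠ 0}, with closure Z. There X and Z
share local dimension and tangent spaces, so generic smoothness of the affine cone over Z suffices.
That follows from Kähler differentials in characteristic zero: they are generically free of rank the
dimension, and their fibre at a rational point is dual to the tangent space. -/

namespace MLDataSingular

/-! ### Generic rank of Kähler differentials -/

section GenericSmoothness

open scoped TensorProduct nonZeroDivisors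

/-- Integral injective extensions preserve the Krull dimension. -/
theorem ringKrullDim_eq_of_isIntegral (R S : Type*) [CommRing R] [CommRing S] [Algebra R S]
    [Algebra.IsIntegral R S] (hinj : Function.Injective (algebraMap R S)) :
    ringKrullDim S = ringKrullDim R := by
  apply le_antisymm
  · refine Order.krullDim_le_of_strictMono (PrimeSpectrum.comap (algebraMap R S)) ?_
    intro P Q h
    exact Ideal.IsIntegral.comap_lt_comap (show P.asIdeal < Q.asIdeal from h)
  · refine iSup_le fun l => ?_
    obtain ⟨Q, hQ, hQl⟩ : ∃ Q : Ideal S,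
        Q.IsPrime ∧ Q.comap (algebraMap R S) = l.head.asIdeal := by
      obtain ⟨Q, -, hQ, h⟩ := Ideal.exists_ideal_over_prime_of_isIntegral l.head.asIdeal
        (⊥ : Ideal S) (by
          intro x hx
          have : algebraMap R S x = 0 := by simpa using hx
          rw [(map_eq_zero_iff _ hinj).1 this]
          exact zero_mem _)
      exact ⟨Q, hQ, h⟩
    have : Q.LiesOver l.head.asIdeal := ⟨hQl.symm⟩
    obtain ⟨L, hL, -⟩ := Ideal.exists_ltSeries_of_hasGoingUp l Q
    rw [← hL]
    exact le_iSup (fun p : LTSeries (PrimeSpectrum S) => ((p.length : ℕ) : WithBot ℕ∞)) L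

variable (k A : Type*) [Field k] [CharZero k] [CommRing A] [IsDomain A] [Algebra k A]
  [Algebra.FiniteType k A]

/-- The Kähler differentials of the function field of an affine variety in characteristic zero have
the dimension of the variety. -/
theorem finrank_kaehlerDifferential_fractionRing :
    (Module.finrank (FractionRing A) Ω[FractionRing A⁄k] : WithBot ℕ∞) = ringKrullDim A := by
  -- Noether normalization: A is finite over B = k[X_1,…,X_s], so dim A = s. Frac A is separable
  -- algebraic over Frac B in characteristic zero, hence formally étale over B, and its
  -- differentials are those of B base changed.
  obtain ⟨s, g, hg, hfin⟩ := exists_finite_inj_algHom_of_fg k A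
  let := g.toRingHom.toAlgebra
  have : IsScalarTower k (MvPolynomial (Fin s) k) A :=
    IsScalarTower.of_algebraMap_eq' g.comp_algebraMap.symm
  have : Module.Finite (MvPolynomial (Fin s) k) A := hfin
  have hinj : Function.Injective (algebraMap (MvPolynomial (Fin s) k) A) := hg
  have : FaithfulSMul (MvPolynomial (Fin s) k) A :=
    (faithfulSMul_iff_algebraMap_injective _ _).2 hinj
  rw [ringKrullDim_eq_of_isIntegral _ _ hinj, MvPolynomial.ringKrullDim_of_isNoetherianRing,
    ringKrullDim_eq_zero_of_field]
  let B := MvPolynomial (Fin s) k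
  let F := FractionRing B
  let K := FractionRing A
  have : IsScalarTower k B K := IsScalarTower.to₁₂₄ k B A K
  have : FaithfulSMul B K := FaithfulSMul.trans B A K
  let : Algebra F K := FractionRing.liftAlgebra B K
  have : IsScalarTower B F K := inferInstance
  have : CharZero F := charZero_of_injective_algebraMap (algebraMap k F).injective
  have : Algebra.IsAlgebraic F K := inferInstance
  have : Algebra.FormallyEtale F K := Algebra.FormallyEtale.of_isSeparable F K
  have : Algebra.FormallyEtale B F := Algebra.FormallyEtale.of_isLocalization B⁰
  have : Algebra.FormallyEtale B K := Algebra.FormallyEtale.comp B F K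
  have e := KaehlerDifferential.tensorKaehlerEquivOfFormallyEtale k B K
  have b := KaehlerDifferential.mvPolynomialBasis k (Fin s)
  have : Module.Free B Ω[B⁄k] := Module.Free.of_basis b
  rw [← e.finrank_eq, Module.finrank_baseChange, Module.finrank_eq_nat_card_basis b]
  simp

/-- Generic freeness of the Kähler differentials, in terms of the ranks of their fibres. -/
theorem exists_finrank_baseChange_kaehlerDifferential :
    ∃ h : A, h ≠ 0 ∧ ∀ (L : Type*) [Field L] [Algebra A L], algebraMap A L h ≠ 0 →
      (Module.finrank L (L ⊗[A] Ω[A⁄k]) : WithBot ℕ∞) = ringKrullDim A := by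
  have : IsNoetherianRing A := Algebra.FiniteType.isNoetherianRing k A
  have : Module.FinitePresentation A Ω[A⁄k] := Module.finitePresentation_of_finite A _
  -- Freeness over the fraction field already holds after inverting a single h. Any L in which h is
  -- invertible receives a map from A_h, and base change keeps the rank.
  obtain ⟨h, hh, hfree, hrank⟩ := Module.FinitePresentation.exists_free_localizedModule_powers
    A⁰ (KaehlerDifferential.map k k A (FractionRing A)) (FractionRing A)
  refine ⟨h, nonZeroDivisors.ne_zero hh, fun L _ _ hL => ?_⟩
  rw [← finrank_kaehlerDifferential_fractionRing k A, ← hrank]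
  let : Algebra (Localization (.powers h)) L :=
    (IsLocalization.Away.lift (S := Localization (.powers h)) h (g := algebraMap A L)
      (isUnit_iff_ne_zero.2 hL)).toAlgebra
  have : IsScalarTower A (Localization (.powers h)) L := IsScalarTower.of_algebraMap_eq fun x =>
    (IsLocalization.Away.lift_eq (S := Localization (.powers h)) h (g := algebraMap A L)
      (isUnit_iff_ne_zero.2 hL) x).symm
  have e1 := ((isLocalizedModule_iff_isBaseChange (.powers h) (Localization (.powers h))
    (LocalizedModule.mkLinearMap (.powers h) Ω[A⁄k])).1 inferInstance).equiv
  have e2 := TensorProduct.AlgebraTensorModule.cancelBaseChange A (Localization (.powers h)) L L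
    Ω[A⁄k]
  have e3 := (TensorProduct.AlgebraTensorModule.congr (LinearEquiv.refl L L) e1)
  have : Nontrivial (Localization (.powers h)) :=
    (algebraMap (Localization (.powers h)) L).domain_nontrivial
  rw [← e2.finrank_eq, e3.finrank_eq, Module.finrank_baseChange]

end GenericSmoothness

/-! ### Zariski tangent spaces of affine varieties -/

section TangentSpace

open scoped TensorProduct

variable {σ k : Type*} [Fintype σ] [Field k]

/-- The differential of `f` at `x`, as a linear form. -/
noncomputable def differentialAt (x : σ → k) (f : MvPolynomial σ k) : Module.Dual k (σ → k) :=
  ∑ i, MvPolynomial.eval x (MvPolynomial.pderiv i f) • LinearMap.proj i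

theorem differentialAt_apply (x : σ → k) (f : MvPolynomial σ k) (v : σ → k) :
    differentialAt x f v = ∑ i, MvPolynomial.eval x (MvPolynomial.pderiv i f) * v i := by
  simp [differentialAt]

theorem differentialAt_add (x : σ → k) (f g : MvPolynomial σ k) :
    differentialAt x (f + g) = differentialAt x f + differentialAt x g := by
  simp [differentialAt, add_smul, Finset.sum_add_distrib]

theorem differentialAt_mul (x : σ → k) (f g : MvPolynomial σ k) :
    differentialAt x (f * g) =
      MvPolynomial.eval x f • differentialAt x g + MvPolynomial.eval x g • differentialAt x f := by
  simp [differentialAt, add_smul, Finset.sum_add_distrib, Finset.smul_sum, mul_smul]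

theorem differentialAt_C (x : σ → k) (c : k) :
    differentialAt x (MvPolynomial.C c) = 0 := by
  simp [differentialAt]

theorem differentialAt_X (x : σ → k) (i : σ) :
    differentialAt x (MvPolynomial.X i) = LinearMap.proj i := by
  classical
  simp [differentialAt, MvPolynomial.pderiv_X, Pi.single_apply]

theorem differentialAt_smul (x : σ → k) (c : k) (f : MvPolynomial σ k) :
    differentialAt x (c • f) = c • differentialAt x f := by
  rw [MvPolynomial.smul_eq_C_mul, differentialAt_mul, differentialAt_C]
  simp

/-- The Zariski tangent space at `x` of the subscheme cut out by `I`. -/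
noncomputable def idealTangentSpace (I : Ideal (MvPolynomial σ k)) (x : σ → k) :
    Submodule k (σ → k) :=
  ⨅ f ∈ I, LinearMap.ker (differentialAt x f)

theorem mem_idealTangentSpace {I : Ideal (MvPolynomial σ k)} {x v : σ → k} :
    v ∈ idealTangentSpace I x ↔ ∀ f ∈ I, differentialAt x f v = 0 := by
  simp [idealTangentSpace]

/-- The tangent space at a rational point is dual to the fibre of the Kähler differentials. -/
theorem finrank_idealTangentSpace {I : Ideal (MvPolynomial σ k)} {x : σ → k}
    [Algebra (MvPolynomial σ k ⧸ I) k] [IsScalarTower k (MvPolynomial σ k ⧸ I) k]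
    (hx : ∀ f, algebraMap (MvPolynomial σ k ⧸ I) k (Ideal.Quotient.mk I f) =
      MvPolynomial.eval x f) :
    Module.finrank k (idealTangentSpace I x) =
      Module.finrank k (k ⊗[MvPolynomial σ k ⧸ I] Ω[(MvPolynomial σ k ⧸ I)⁄k]) := by
  have smul_def (f : MvPolynomial σ k) (c : k) :
      (Ideal.Quotient.mk I f) • c = MvPolynomial.eval x f * c := by
    rw [Algebra.smul_def, hx]
  -- Both sides are compared with the k-valued derivations at x: these are dual to the fibre of Ω,
  -- and `φ` identifies them with tangent vectors through their values on coordinates.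
  let e1 : (Ω[(MvPolynomial σ k ⧸ I)⁄k] →ₗ[MvPolynomial σ k ⧸ I] k) ≃ₗ[k]
      Derivation k (MvPolynomial σ k ⧸ I) k :=
    (KaehlerDifferential.linearMapEquivDerivation k (MvPolynomial σ k ⧸ I)).restrictScalars k
  let e2 : (Ω[(MvPolynomial σ k ⧸ I)⁄k] →ₗ[MvPolynomial σ k ⧸ I] k) ≃ₗ[k]
      Module.Dual k (k ⊗[MvPolynomial σ k ⧸ I] Ω[(MvPolynomial σ k ⧸ I)⁄k]) :=
    LinearMap.liftBaseChangeEquiv k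
  let φ : Derivation k (MvPolynomial σ k ⧸ I) k →ₗ[k] (σ → k) :=
    { toFun D i := D (Ideal.Quotient.mk I (MvPolynomial.X i))
      map_add' _ _ := rfl
      map_smul' _ _ := rfl }
  have hD (D : Derivation k (MvPolynomial σ k ⧸ I) k) (f : MvPolynomial σ k) :
      D (Ideal.Quotient.mk I f) = differentialAt x f (φ D) := by
    induction f using MvPolynomial.induction_on with
    | C c =>
      rw [differentialAt_C]
      exact D.map_algebraMap c
    | add p q hp hq => rw [map_add, map_add, hp, hq, differentialAt_add, LinearMap.add_apply]
    | mul_X p i hp =>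
      rw [map_mul, D.leibniz, smul_def, smul_def, hp, differentialAt_mul, differentialAt_X]
      rfl
  have hinj : Function.Injective φ := by
    intro D D' h
    ext a
    obtain ⟨f, rfl⟩ := Ideal.Quotient.mk_surjective a
    rw [hD, hD, h]
  have hrange : LinearMap.range φ = idealTangentSpace I x := by
    ext v
    rw [mem_idealTangentSpace]
    constructor
    · rintro ⟨D, rfl⟩ f hf
      rw [← hD, Ideal.Quotient.eq_zero_iff_mem.2 hf, map_zero]
    · intro hv
      let d : MvPolynomial σ k →ₗ[k] k :=
        { toFun f := differentialAt x f v
          map_add' f g := by rw [differentialAt_add, LinearMap.add_apply]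
          map_smul' c f := by rw [differentialAt_smul]; rfl }
      let d' : (MvPolynomial σ k ⧸ I) →ₗ[k] k := Submodule.liftQ (I.restrictScalars k) d hv
      have hd' (f) : d' (Ideal.Quotient.mk I f) = differentialAt x f v := rfl
      refine ⟨Derivation.mk' d' ?_, ?_⟩
      · intro a b
        obtain ⟨f, rfl⟩ := Ideal.Quotient.mk_surjective a
        obtain ⟨g, rfl⟩ := Ideal.Quotient.mk_surjective b
        rw [← map_mul, hd', hd', hd', smul_def, smul_def, differentialAt_mul]
        rfl
      · funext i
        change d' (Ideal.Quotient.mk I (MvPolynomial.X i)) = v i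
        rw [hd', differentialAt_X]
        rfl
  rw [← hrange, LinearMap.finrank_range_of_inj hinj, ← e1.finrank_eq, e2.finrank_eq,
    Subspace.dual_finrank_eq]

/-- Generic smoothness: on a dense open subset of an affine variety over a field of characteristic
zero, the tangent spaces at rational points have the dimension of the variety. -/
theorem exists_finrank_idealTangentSpace_eq [CharZero k] (I : Ideal (MvPolynomial σ k))
    [I.IsPrime] :
    ∃ h ∉ I, ∀ x : σ → k, (∀ f ∈ I, MvPolynomial.eval x f = 0) → MvPolynomial.eval x h ≠ 0 →
      (Module.finrank k (idealTangentSpace I x) : WithBot ℕ∞) =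
        ringKrullDim (MvPolynomial σ k ⧸ I) := by
  obtain ⟨a, ha, H⟩ :=
    exists_finrank_baseChange_kaehlerDifferential k (MvPolynomial σ k ⧸ I)
  obtain ⟨h, rfl⟩ := Ideal.Quotient.mk_surjective a
  refine ⟨h, fun hI => ha (Ideal.Quotient.eq_zero_iff_mem.2 hI), fun x hx hhx => ?_⟩
  let q : (MvPolynomial σ k ⧸ I) →ₐ[k] k := Ideal.Quotient.liftₐ I (MvPolynomial.aeval x)
    (fun f hf => by rw [MvPolynomial.aeval_eq_eval]; exact hx f hf)
  let _ : Algebra (MvPolynomial σ k ⧸ I) k := q.toRingHom.toAlgebra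
  have : IsScalarTower k (MvPolynomial σ k ⧸ I) k :=
    IsScalarTower.of_algebraMap_eq' q.comp_algebraMap.symm
  have hq (f) : algebraMap (MvPolynomial σ k ⧸ I) k (Ideal.Quotient.mk I f) =
      MvPolynomial.eval x f := by
    rw [← MvPolynomial.aeval_eq_eval]
    rfl
  rw [finrank_idealTangentSpace hq, H]
  rwa [hq]

end TangentSpace

/-! ### Density of the regular locus -/

section RegularLocus

open MvPolynomial

theorem eval_smul_of_isHomogeneous {σ k : Type*} [Fintype σ] [CommSemiring k]
    {f : MvPolynomial σ k} {d : ℕ} (hf : f.IsHomogeneous d) (c : k) (x : σ → k) :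
    eval (c • x) f = c ^ d * eval x f := by
  rw [eval_eq', eval_eq', Finset.mul_sum]
  refine Finset.sum_congr rfl fun m hm => ?_
  have hd : ∑ i, m i = d := by
    rw [← hf (mem_support_iff.1 hm), Finsupp.weight_apply, Finsupp.sum_fintype _ _ (by simp)]
    simp
  simp only [Pi.smul_apply, smul_eq_mul, mul_pow, Finset.prod_mul_distrib,
    Finset.prod_pow_eq_pow_sum, hd]
  ring

/-- For d = 0 the truncated exponent is harmless: f is constant and both sides vanish. -/
theorem differentialAt_smul_point {σ k : Type*} [Fintype σ] [Field k]
    {f : MvPolynomial σ k} {d : ℕ} (hf : f.IsHomogeneous d) (c : k) (x : σ → k) :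
    differentialAt (c • x) f = c ^ (d - 1) • differentialAt x f := by
  ext v
  simp only [differentialAt, eval_smul_of_isHomogeneous hf.pderiv, mul_smul, Finset.smul_sum]

/-- If `h` vanishes on the punctured line through `x`, so does each homogeneous component. -/
theorem eval_homogeneousComponent_eq_zero {σ k : Type*} [Fintype σ] [Field k] [Infinite k]
    {h : MvPolynomial σ k} {x : σ → k} (H : ∀ c : k, c ≠ 0 → eval (c • x) h = 0) (j : ℕ) :
    eval x (homogeneousComponent j h) = 0 := by
  -- `r` is h(c • x) as a polynomial in c; all c ≠ 0 are roots, and its coefficients are the values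
  -- sought.
  let r : Polynomial k := ∑ i ∈ Finset.range (h.totalDegree + 1),
    Polynomial.monomial i (eval x (homogeneousComponent i h))
  have hr : r = 0 := by
    refine Polynomial.eq_zero_of_infinite_isRoot r
      (((Set.finite_singleton (0 : k)).infinite_compl).mono fun c hc => ?_)
    have h1 := H c hc
    rw [← sum_homogeneousComponent h, map_sum] at h1
    simp only [eval_smul_of_isHomogeneous (homogeneousComponent_isHomogeneous _ _)] at h1
    change Polynomial.eval c r = 0
    rw [← h1, Polynomial.eval_finsetSum]
    exact Finset.sum_congr rfl fun i _ => by rw [Polynomial.eval_monomial, mul_comm]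
  by_cases hj : j ≤ h.totalDegree
  · have h2 : r.coeff j = 0 := by rw [hr, Polynomial.coeff_zero]
    rwa [Polynomial.finsetSum_coeff, Finset.sum_eq_single j
      (fun i _ hi => Polynomial.coeff_monomial_of_ne _ hi.symm)
      (fun hn => absurd (Finset.mem_range.2 (Nat.lt_succ_of_le hj)) hn),
      Polynomial.coeff_monomial, if_pos rfl] at h2
  · rw [homogeneousComponent_eq_zero _ _ (not_le.1 hj), map_zero]

variable {n : ℕ} {X Y Z : Set (PSpace n)}

theorem homogeneousVanishing_anti (h : X ⊆ Y) :
    homogeneousVanishing Y ⊆ homogeneousVanishing X :=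
  fun _ hf => ⟨hf.1, fun p hp => hf.2 p (h hp)⟩

theorem projVanishingIdeal_anti (h : X ⊆ Y) : projVanishingIdeal Y ≤ projVanishingIdeal X :=
  Ideal.span_mono (homogeneousVanishing_anti h)

theorem eval_eq_zero_of_mem_projVanishingIdeal {f : CoordPoly n} (hf : f ∈ projVanishingIdeal X)
    {p : PSpace n} (hp : p ∈ X) (c : ℂ) : eval (c • p.rep) f = 0 := by
  have : projVanishingIdeal X ≤ RingHom.ker (eval (c • p.rep)) := by
    refine Ideal.span_le.2 fun f hf => ?_
    obtain ⟨⟨d, hd⟩, hv⟩ := hf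
    have hv' : eval p.rep f = 0 := hv p hp
    change eval (c • p.rep) f = 0
    rw [eval_smul_of_isHomogeneous hd, hv', mul_zero]
  exact this hf

theorem vanishes_of_mem_projVanishingIdeal {f : CoordPoly n} (hf : f ∈ projVanishingIdeal X)
    {p : PSpace n} (hp : p ∈ X) : Vanishes f p := by
  have := eval_eq_zero_of_mem_projVanishingIdeal hf hp 1
  rwa [one_smul] at this

theorem mem_projVanishingIdeal_of_isHomogeneous {f : CoordPoly n} {d : ℕ} (hf : f.IsHomogeneous d) :
    f ∈ projVanishingIdeal X ↔ ∀ p ∈ X, Vanishes f p :=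
  ⟨fun h _ hp => vanishes_of_mem_projVanishingIdeal h hp,
    fun h => Ideal.subset_span ⟨⟨d, hf⟩, h⟩⟩

/-- Some homogeneous component of h is nonzero at a point of X. Since h itself need not be
homogeneous, the representative may have to be rescaled. -/
theorem exists_eval_ne_zero_of_notMem_projVanishingIdeal {h : CoordPoly n}
    (hh : h ∉ projVanishingIdeal X) :
    ∃ p ∈ X, ∃ c : ℂ, c ≠ 0 ∧ eval (c • p.rep) h ≠ 0 := by
  by_contra! H
  refine hh ?_
  rw [← sum_homogeneousComponent h]
  refine Ideal.sum_mem _ fun j _ => ?_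
  rw [mem_projVanishingIdeal_of_isHomogeneous (homogeneousComponent_isHomogeneous j h)]
  exact fun p hp => eval_homogeneousComponent_eq_zero (H p hp) j

theorem mem_tangentSpace_iff {p : PSpace n} {v : Fin (n + 2) → ℂ} :
    v ∈ tangentSpace X p ↔ ∀ f ∈ homogeneousVanishing X, differentialAt p.rep f v = 0 := by
  simp only [differentialAt_apply]
  rfl

/-- Rescaling multiplies differentials of homogeneous polynomials by nonzero constants, and by
Leibniz the generators impose all the conditions, as they vanish at the point. Generic smoothness
controls only some multiple of `p.rep`, hence the c. -/
theorem tangentSpace_eq_idealTangentSpace {p : PSpace n} (hp : p ∈ X) {c : ℂ} (hc : c ≠ 0) :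
    tangentSpace X p = idealTangentSpace (projVanishingIdeal X) (c • p.rep) := by
  ext v
  rw [mem_tangentSpace_iff, mem_idealTangentSpace]
  constructor
  · intro hv f hf
    induction hf using Submodule.span_induction with
    | mem f hf =>
      obtain ⟨d, hd⟩ := hf.1
      rw [differentialAt_smul_point hd, LinearMap.smul_apply, hv f hf, smul_zero]
    | zero => rw [← C_0, differentialAt_C, LinearMap.zero_apply]
    | add f g _ _ hf hg => rw [differentialAt_add, LinearMap.add_apply, hf, hg, add_zero]
    | smul a f hf' hf =>
      rw [smul_eq_mul, differentialAt_mul, LinearMap.add_apply, LinearMap.smul_apply,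
        LinearMap.smul_apply, hf, eval_eq_zero_of_mem_projVanishingIdeal hf' hp c]
      simp
  · intro hv f hf
    obtain ⟨d, hd⟩ := hf.1
    have h := hv f (Ideal.subset_span hf)
    rw [differentialAt_smul_point hd, LinearMap.smul_apply, smul_eq_mul] at h
    exact (mul_eq_zero.1 h).resolve_left (pow_ne_zero _ hc)

theorem coneDim_mono (h : X ⊆ Y) : coneDim X ≤ coneDim Y :=
  ringKrullDim_le_of_surjective (Ideal.Quotient.factor (projVanishingIdeal_anti h))
    (Ideal.Quotient.factor_surjective (projVanishingIdeal_anti h))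

-- Primality of a homogeneous ideal can be tested on homogeneous elements.
attribute [local instance] MvPolynomial.gradedAlgebra in
theorem isPrime_projVanishingIdeal (hne : X.Nonempty)
    (hmul : ∀ a b : CoordPoly n, (∃ d, a.IsHomogeneous d) → (∃ d, b.IsHomogeneous d) →
      (∀ p ∈ X, Vanishes (a * b) p) → (∀ p ∈ X, Vanishes a p) ∨ ∀ p ∈ X, Vanishes b p) :
    (projVanishingIdeal X).IsPrime := by
  have hhom : (projVanishingIdeal X).IsHomogeneous (homogeneousSubmodule (Fin (n + 2)) ℂ) :=
    Ideal.homogeneous_span _ _ fun f hf => hf.1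
  refine hhom.isPrime_of_homogeneous_mem_or_mem ?_ ?_
  · intro htop
    obtain ⟨p, hp⟩ := hne
    have h1 : (1 : CoordPoly n) ∈ projVanishingIdeal X := htop ▸ Submodule.mem_top
    have h2 : eval p.rep (1 : CoordPoly n) = 0 := vanishes_of_mem_projVanishingIdeal h1 hp
    simp at h2
  · rintro a b ⟨d, ha⟩ ⟨e, hb⟩ hab
    have ha' : a.IsHomogeneous d := ha
    have hb' : b.IsHomogeneous e := hb
    rw [mem_projVanishingIdeal_of_isHomogeneous ha', mem_projVanishingIdeal_of_isHomogeneous hb']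
    exact hmul a b ⟨d, ha'⟩ ⟨e, hb'⟩ fun p hp => vanishes_of_mem_projVanishingIdeal hab hp

/-- The Zariski closure of a subset of projective space. -/
def projClosure (D : Set (PSpace n)) : Set (PSpace n) :=
  {p | ∀ f ∈ homogeneousVanishing D, Vanishes f p}

theorem subset_projClosure (D : Set (PSpace n)) : D ⊆ projClosure D :=
  fun p hp _ hf => hf.2 p hp

theorem isProjectiveVariety_projClosure (D : Set (PSpace n)) :
    IsProjectiveVariety (projClosure D) :=
  ⟨homogeneousVanishing D, fun _ hf => hf.1, rfl⟩

theorem projClosure_subset {D : Set (PSpace n)} (hX : IsProjectiveVariety X) (h : D ⊆ X) :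
    projClosure D ⊆ X := by
  obtain ⟨S, hS, rfl⟩ := hX
  exact fun p hp f hf => hp f ⟨hS f hf, fun q hq => h hq f hf⟩

theorem exists_notVanishes_of_not_subset (hX : IsProjectiveVariety X) (h : ¬ Z ⊆ X) :
    ∃ f ∈ homogeneousVanishing X, ∃ p ∈ Z, ¬ Vanishes f p := by
  obtain ⟨S, hS, rfl⟩ := hX
  obtain ⟨p, hp, hpX⟩ := Set.not_subset.1 h
  obtain ⟨f, hf, hfp⟩ : ∃ f ∈ S, ¬ Vanishes f p := by simpa using hpX
  exact ⟨f, ⟨hS f hf, fun q hq => hq f hf⟩, p, hp, hfp⟩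

theorem vanishes_mul {f g : CoordPoly n} {p : PSpace n} :
    Vanishes (f * g) p ↔ Vanishes f p ∨ Vanishes g p := by
  simp [Vanishes]

/-- A variety is irreducible as soon as its homogeneous vanishing polynomials behave like a
homogeneous prime ideal. -/
theorem isIrreducibleVariety_of_mul (hZ : IsProjectiveVariety Z) (hne : Z.Nonempty)
    (hmul : ∀ a b : CoordPoly n, (∃ d, a.IsHomogeneous d) → (∃ d, b.IsHomogeneous d) →
      (∀ p ∈ Z, Vanishes (a * b) p) → (∀ p ∈ Z, Vanishes a p) ∨ ∀ p ∈ Z, Vanishes b p) :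
    IsIrreducibleVariety Z := by
  refine ⟨hZ, hne, fun A B hA hB hAB => ?_⟩
  by_contra! H
  obtain ⟨a, ha, p, hp, hap⟩ := exists_notVanishes_of_not_subset hA H.1
  obtain ⟨b, hb, q, hq, hbq⟩ := exists_notVanishes_of_not_subset hB H.2
  rcases hmul a b ha.1 hb.1 (fun r hr => vanishes_mul.2 ((hAB hr).imp (ha.2 r) (hb.2 r)))
    with h | h
  · exact hap (h p hp)
  · exact hbq (h q hq)

/-- Inside any nonempty open subset `X ∩ {G ≠ 0}` there is a nonempty open subset
`X ∩ {g ≠ 0}` on which products of homogeneous polynomials vanish only if a factor does. -/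
theorem exists_irreducible_open {G : CoordPoly n} {d : ℕ} (hG : G.IsHomogeneous d)
    {p : PSpace n} (hp : p ∈ X) (hGp : ¬ Vanishes G p) :
    ∃ g : CoordPoly n, (∃ e, g.IsHomogeneous e) ∧ G ∣ g ∧ {q ∈ X | ¬ Vanishes g q}.Nonempty ∧
      ∀ a b : CoordPoly n, (∃ d, a.IsHomogeneous d) → (∃ d, b.IsHomogeneous d) →
      (∀ q ∈ {q ∈ X | ¬ Vanishes g q}, Vanishes (a * b) q) →
      (∀ q ∈ {q ∈ X | ¬ Vanishes g q}, Vanishes a q) ∨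
        ∀ q ∈ {q ∈ X | ¬ Vanishes g q}, Vanishes b q := by
  -- Take g with the vanishing ideal of X ∩ {g ≠ 0} maximal. If ab vanishes there and a does not,
  -- passing to ga cannot enlarge the ideal, yet b vanishes where ga ≠ 0; so b was already in it.
  obtain ⟨I, ⟨g, hg, hGg, hne, rfl⟩, hmax⟩ := set_has_maximal_iff_noetherian.2
    (inferInstance : IsNoetherianRing (CoordPoly n))
    {I | ∃ g : CoordPoly n, (∃ e, g.IsHomogeneous e) ∧ G ∣ g ∧
      {q ∈ X | ¬ Vanishes g q}.Nonempty ∧ I = projVanishingIdeal {q ∈ X | ¬ Vanishes g q}}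
    ⟨_, G, ⟨d, hG⟩, dvd_rfl, ⟨p, hp, hGp⟩, rfl⟩
  refine ⟨g, hg, hGg, hne, fun a b ha hb hab => ?_⟩
  by_contra! H
  obtain ⟨⟨q, hq, haq⟩, H⟩ := H
  obtain ⟨e, hg⟩ := hg
  obtain ⟨e', ha⟩ := ha
  obtain ⟨e'', hb⟩ := hb
  have hle : {q ∈ X | ¬ Vanishes (g * a) q} ⊆ {q ∈ X | ¬ Vanishes g q} :=
    fun r hr => ⟨hr.1, fun h => hr.2 (vanishes_mul.2 (Or.inl h))⟩
  have heq : projVanishingIdeal {q ∈ X | ¬ Vanishes (g * a) q} =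
      projVanishingIdeal {q ∈ X | ¬ Vanishes g q} := by
    refine ((projVanishingIdeal_anti hle).eq_or_lt.resolve_right (hmax _ ?_)).symm
    exact ⟨g * a, ⟨_, hg.mul ha⟩, hGg.mul_right a,
      ⟨q, hq.1, fun h => (vanishes_mul.1 h).elim hq.2 haq⟩, rfl⟩
  have hb' : b ∈ projVanishingIdeal {q ∈ X | ¬ Vanishes (g * a) q} :=
    (mem_projVanishingIdeal_of_isHomogeneous hb).2 fun r hr =>
      (vanishes_mul.1 (hab r (hle hr))).resolve_left
        fun h => hr.2 (vanishes_mul.2 (Or.inr h))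
  rw [heq, mem_projVanishingIdeal_of_isHomogeneous hb] at hb'
  obtain ⟨r, hr, hbr⟩ := H
  exact hbr (hb' r hr)

/-- An irreducible W ⊆ X through p is covered by Z and {g = 0}; as g(p) ≠ 0, it lies in Z. -/
theorem localConeDim_eq {g : CoordPoly n} (hg : ∃ e, g.IsHomogeneous e) {p : PSpace n}
    (hpZ : p ∈ Z) (hgp : ¬ Vanishes g p) (hZ : IsIrreducibleVariety Z) (hZX : Z ⊆ X)
    (hXZ : ∀ q ∈ X, ¬ Vanishes g q → q ∈ Z) : localConeDim X p = coneDim Z := by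
  refine le_antisymm (iSup₂_le fun W hW => coneDim_mono ?_)
    (le_iSup₂_of_le Z ⟨hZ, hpZ, hZX⟩ le_rfl)
  obtain ⟨hWirr, hpW, hWX⟩ := hW
  refine (hWirr.2.2 Z {q | Vanishes g q} hZ.1 ⟨{g}, by simpa using hg, by simp⟩ fun q hq => ?_
    ).resolve_right fun h => hgp (h hpW)
  by_cases h : Vanishes g q
  · exact Or.inr h
  · exact Or.inl (hXZ q (hWX hq) h)

/-- If f vanishes on Z, then gf vanishes on X, and its differential at p is g(p) times that of f. -/
theorem tangentSpace_eq_of_open {g : CoordPoly n} (hg : ∃ e, g.IsHomogeneous e) {p : PSpace n}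
    (hpZ : p ∈ Z) (hgp : ¬ Vanishes g p) (hZX : Z ⊆ X)
    (hXZ : ∀ q ∈ X, ¬ Vanishes g q → q ∈ Z) : tangentSpace X p = tangentSpace Z p := by
  ext v
  rw [mem_tangentSpace_iff, mem_tangentSpace_iff]
  refine ⟨fun hv f hf => ?_, fun hv f hf => hv f (homogeneousVanishing_anti hZX hf)⟩
  obtain ⟨e, hg⟩ := hg
  obtain ⟨d, hd⟩ := hf.1
  have h := hv (g * f) ⟨⟨_, hg.mul hd⟩, fun q hq => by
    by_cases h : Vanishes g q
    · exact vanishes_mul.2 (Or.inl h)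
    · exact vanishes_mul.2 (Or.inr (hf.2 q (hXZ q hq h)))⟩
  have hfp : eval p.rep f = 0 := hf.2 p hpZ
  rw [differentialAt_mul, hfp, zero_smul, add_zero, LinearMap.smul_apply, smul_eq_mul] at h
  exact (mul_eq_zero.1 h).resolve_left hgp

/-- The regular points of a projective variety are Zariski dense. -/
theorem exists_mem_regularLocus (hX : IsProjectiveVariety X) {G : CoordPoly n} {d : ℕ}
    (hG : G.IsHomogeneous d) {p : PSpace n} (hp : p ∈ X) (hGp : ¬ Vanishes G p) :
    ∃ q ∈ regularLocus X, ¬ Vanishes G q := by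
  obtain ⟨g, hg, hGg, hne, hmul⟩ := exists_irreducible_open hG hp hGp
  set D : Set (PSpace n) := {q ∈ X | ¬ Vanishes g q}
  set Z := projClosure D
  have hDZ : D ⊆ Z := subset_projClosure D
  have hZX : Z ⊆ X := projClosure_subset hX fun q hq => hq.1
  have hvan {f : CoordPoly n} (hf : ∃ d, f.IsHomogeneous d) :
      (∀ q ∈ Z, Vanishes f q) ↔ ∀ q ∈ D, Vanishes f q :=
    ⟨fun h q hq => h q (hDZ hq), fun h q hq => hq f ⟨hf, h⟩⟩
  have hmulZ : ∀ a b : CoordPoly n, (∃ d, a.IsHomogeneous d) → (∃ d, b.IsHomogeneous d) →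
      (∀ p ∈ Z, Vanishes (a * b) p) → (∀ p ∈ Z, Vanishes a p) ∨ ∀ p ∈ Z, Vanishes b p := by
    intro a b ha hb hab
    rw [hvan ha, hvan hb]
    exact hmul a b ha hb fun q hq => hab q (hDZ hq)
  have hneZ : Z.Nonempty := hne.mono hDZ
  have hirr : IsIrreducibleVariety Z :=
    isIrreducibleVariety_of_mul (isProjectiveVariety_projClosure D) hneZ hmulZ
  have hprime := isPrime_projVanishingIdeal hneZ hmulZ
  obtain ⟨h, hh, hrank⟩ := exists_finrank_idealTangentSpace_eq (projVanishingIdeal Z)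
  have hgZ : g ∉ projVanishingIdeal Z := by
    intro hmem
    obtain ⟨q, hq⟩ := hne
    exact hq.2 (vanishes_of_mem_projVanishingIdeal hmem (hDZ hq))
  -- Primality yields a point of the cone where g and h are both nonzero: g puts it in the open
  -- part, h makes it smooth.
  obtain ⟨q, hqZ, c, hc, hq⟩ := exists_eval_ne_zero_of_notMem_projVanishingIdeal
    (fun hmem => (hprime.mem_or_mem hmem).elim hgZ hh : g * h ∉ projVanishingIdeal Z)
  rw [map_mul] at hq
  have hgq : ¬ Vanishes g q := by
    obtain ⟨e, he⟩ := hg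
    intro h0
    have h0' : eval q.rep g = 0 := h0
    rw [eval_smul_of_isHomogeneous he, h0'] at hq
    simp at hq
  have hXZ : ∀ r ∈ X, ¬ Vanishes g r → r ∈ Z := fun r hr hgr => hDZ ⟨hr, hgr⟩
  refine ⟨q, ⟨hZX hqZ, ?_⟩, fun h0 => hgq ?_⟩
  · rw [localConeDim_eq hg hqZ hgq hirr hZX hXZ, tangentSpace_eq_of_open hg hqZ hgq hZX hXZ,
      tangentSpace_eq_idealTangentSpace hqZ hc]
    exact hrank _ (fun f hf => eval_eq_zero_of_mem_projVanishingIdeal hf hqZ c)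
      (right_ne_zero_of_mul hq)
  · obtain ⟨k, rfl⟩ := hGg
    exact vanishes_mul.2 (Or.inl h0)

end RegularLocus

/-! ### Closed conditions on the conormal variety and likelihood correspondence -/

section Correspondence

open MvPolynomial

variable {n k : ℕ}

theorem subset_zariskiClosure (S : Set (Fin k → PSpace n)) : S ⊆ zariskiClosure S :=
  fun x hx _ _ h => h x hx

/-- Multihomogeneity is weighted homogeneity for the weights in `ℕ^k` given by the groups. -/
theorem isMultihomogeneous_of_isWeightedHomogeneous {F : MvPolynomial (Fin k × Fin (n + 2)) ℂ}
    {d : Fin k → ℕ}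
    (hF : F.IsWeightedHomogeneous (fun ji => (Pi.single ji.1 1 : Fin k → ℕ)) d) :
    IsMultihomogeneous F := by
  refine ⟨d, fun m hm j => ?_⟩
  rw [← hF (mem_support_iff.1 hm), Finsupp.weight_apply, Finsupp.sum_fintype _ _ (by simp),
    Fintype.sum_prod_type, Finset.sum_apply, Finset.sum_eq_single j]
  · simp
  · intro j' _ hj'
    simp [hj'.symm]
  · simp

/-- Fixing the second point in a bihomogeneous polynomial leaves a homogeneous polynomial in the
first. -/
theorem exists_isHomogeneous_of_isMultihomogeneous {F : MvPolynomial (Fin 2 × Fin (n + 2)) ℂ}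
    (hF : IsMultihomogeneous F) (b : PSpace n) :
    ∃ (G : CoordPoly n) (d : ℕ), G.IsHomogeneous d ∧
      ∀ p, Vanishes G p ↔ MultiVanishes F ![p, b] := by
  obtain ⟨d, hd⟩ := hF
  let s : Fin 2 × Fin (n + 2) → CoordPoly n := fun ji => ![X ji.2, C (b.rep ji.2)] ji.1
  refine ⟨eval₂ C s F, d 0, ?_, fun p => ?_⟩
  · rw [eval₂_eq']
    refine IsHomogeneous.sum _ _ _ fun m hm => ?_
    rw [← zero_add (d 0)]
    refine (isHomogeneous_C _ _).mul ?_
    -- Kept variables have degree 1 and substituted constants degree 0, so only the first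
    -- multidegree counts.
    have h : ∑ ji : Fin 2 × Fin (n + 2), ![1, 0] ji.1 * m ji = d 0 := by
      rw [Fintype.sum_prod_type, Fin.sum_univ_two, ← hd m hm 0]
      simp
    rw [← h]
    refine IsHomogeneous.prod _ _ _ fun ji _ => IsHomogeneous.pow ?_ _
    obtain ⟨j, i⟩ := ji
    fin_cases j
    · exact isHomogeneous_X _ _
    · exact isHomogeneous_C _ _
  · have h : eval p.rep (eval₂ C s F) =
        eval (fun ji : Fin 2 × Fin (n + 2) => ((![p, b] : Fin 2 → PSpace n) ji.1).rep ji.2) F := by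
      rw [eval_eval₂]
      have hC : (eval p.rep).comp C = RingHom.id ℂ := by ext; simp
      rw [hC, eval, coe_eval₂Hom]
      congr 1
      funext ji
      obtain ⟨j, i⟩ := ji
      fin_cases j <;> simp [s]
    rw [Vanishes, MultiVanishes, h]

variable {X : Set (PSpace n)}

theorem onesVec_dotProduct (v : Fin (n + 2) → ℂ) :
    ∑ i, onesVec n i * v i = ∑ i : Fin (n + 1), v i.castSucc - v (Fin.last (n + 1)) := by
  rw [Fin.sum_univ_castSucc]
  simp [onesVec, sub_eq_add_neg]

theorem onesPoint_rep_dotProduct_eq_zero {v : Fin (n + 2) → ℂ} (h : ∑ i, onesVec n i * v i = 0) :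
    ∑ i, (onesPoint n).rep i * v i = 0 := by
  obtain ⟨a, ha⟩ := Projectivization.exists_smul_eq_mk_rep ℂ (onesVec n) (onesVec_ne_zero n)
  have hrep : (onesPoint n).rep = (a : ℂ) • onesVec n := ha.symm
  simp only [hrep, Pi.smul_apply, smul_eq_mul, mul_assoc]
  rw [← Finset.mul_sum, h, mul_zero]

/-- The hyperplane containing the model contains its tangent spaces. -/
theorem onesVec_dotProduct_tangentSpace (hX : IsAlgebraicStatisticalModel X) {p : PSpace n}
    {v : Fin (n + 2) → ℂ} (hv : v ∈ tangentSpace X p) : ∑ i, onesVec n i * v i = 0 := by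
  have hmem : ∑ i, C (onesVec n i) * MvPolynomial.X i ∈ homogeneousVanishing X := by
    refine ⟨⟨0 + 1, IsHomogeneous.sum _ _ _ fun i _ =>
      (isHomogeneous_C _ _).mul (isHomogeneous_X _ _)⟩, fun q hq => ?_⟩
    simp only [Vanishes, map_sum, map_mul, eval_C, eval_X]
    rw [onesVec_dotProduct, hX.mem_hyperplane q hq]
  have h := hv _ hmem
  rw [← h]
  refine Finset.sum_congr rfl fun i _ => ?_
  simp [pderiv_X, Pi.single_apply]

/-- A test polynomial nonzero at this pair would, with its second argument fixed, be nonzero at some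
regular q by density; but q paired with the same point is in the set being closed. -/
theorem mem_conormalVariety_onesPoint (hX : IsAlgebraicStatisticalModel X) {p : PSpace n}
    (hp : p ∈ X) : ![p, onesPoint n] ∈ conormalVariety X := by
  intro F hF hvan
  obtain ⟨G, d, hG, hGF⟩ := exists_isHomogeneous_of_isMultihomogeneous hF (onesPoint n)
  rw [← hGF]
  by_contra hGp
  obtain ⟨q, hq, hGq⟩ := exists_mem_regularLocus hX.isProjectiveVariety hG hp hGp
  refine hGq ((hGF q).2 (hvan _ ⟨hq, fun v hv => ?_⟩))
  exact onesPoint_rep_dotProduct_eq_zero (onesVec_dotProduct_tangentSpace hX hv)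

/-- Euler's identity: the point itself lies in the tangent space of the affine cone. -/
theorem rep_mem_tangentSpace {p : PSpace n} (hp : p ∈ X) : p.rep ∈ tangentSpace X p := by
  intro f hf
  obtain ⟨⟨d, hd⟩, hv⟩ := hf
  have h := congrArg (eval p.rep) hd.sum_X_mul_pderiv
  have hv' : eval p.rep f = 0 := hv p hp
  simp only [map_sum, map_mul, eval_X, map_nsmul, hv', smul_zero] at h
  rw [← h]
  exact Finset.sum_congr rfl fun i _ => mul_comm _ _

/-- The pairing is bihomogeneous, and on the set being closed it vanishes because p itself is
tangent. -/
theorem sum_eq_zero_of_mem_conormalVariety {x : Fin 2 → PSpace n} (hx : x ∈ conormalVariety X) :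
    ∑ i, (x 0).rep i * (x 1).rep i = 0 := by
  have h := hx (∑ i, MvPolynomial.X (0, i) * MvPolynomial.X (1, i))
    (isMultihomogeneous_of_isWeightedHomogeneous (d := Pi.single 0 1 + Pi.single 1 1)
      (IsWeightedHomogeneous.sum _ _ _ fun i _ =>
        (isWeightedHomogeneous_X ℂ _ (0, i)).mul (isWeightedHomogeneous_X ℂ _ (1, i))))
    (fun y hy => by
      have h := hy.2 _ (rep_mem_tangentSpace hy.1.1)
      simp only [MultiVanishes, map_sum, map_mul, eval_X]
      rw [← h]
      exact Finset.sum_congr rfl fun i _ => mul_comm _ _)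
  simpa [MultiVanishes] using h

theorem IsMultihomogeneous.rename_castSucc {F : MvPolynomial (Fin k × Fin (n + 2)) ℂ}
    (hF : IsMultihomogeneous F) :
    IsMultihomogeneous (rename (Prod.map Fin.castSucc id) F :
      MvPolynomial (Fin (k + 1) × Fin (n + 2)) ℂ) := by
  classical
  obtain ⟨d, hd⟩ := hF
  have hinj : Function.Injective
      (Prod.map Fin.castSucc id : Fin k × Fin (n + 2) → Fin (k + 1) × Fin (n + 2)) :=
    (Fin.castSucc_injective k).prodMap Function.injective_id
  refine ⟨Fin.snoc d 0, fun m hm j => ?_⟩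
  rw [support_rename_of_injective hinj, Finset.mem_image] at hm
  obtain ⟨m, hm, rfl⟩ := hm
  induction j using Fin.lastCases with
  | last =>
    rw [Fin.snoc_last]
    refine Finset.sum_eq_zero fun i _ => Finsupp.mapDomain_of_notMem_range _ _ ?_
    rintro ⟨⟨j, i'⟩, h⟩
    exact (Fin.castSucc_lt_last j).ne (congrArg Prod.fst h)
  | cast j =>
    rw [Fin.snoc_castSucc, ← hd m hm j]
    exact Finset.sum_congr rfl fun i _ => Finsupp.mapDomain_apply hinj m (j, i)

/-- Test polynomials on pairs pull back to triples, with degree 0 in the third group. -/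
theorem mem_conormalVariety_of_mem_extendedLikelihoodCorrespondence {x : Fin 3 → PSpace n}
    (hx : x ∈ extendedLikelihoodCorrespondence X) : ![x 0, x 1] ∈ conormalVariety X := by
  intro F hF hvan
  have key (y : Fin 3 → PSpace n) : MultiVanishes (rename (Prod.map Fin.castSucc id) F :
      MvPolynomial (Fin (2 + 1) × Fin (n + 2)) ℂ) y ↔ MultiVanishes F ![y 0, y 1] := by
    rw [MultiVanishes, MultiVanishes, eval_rename]
    refine Eq.congr (congrArg (fun s => eval s F) (funext fun ji => ?_)) rfl
    obtain ⟨j, i⟩ := ji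
    fin_cases j <;> rfl
  rw [← key]
  exact hx _ hF.rename_castSucc fun y hy => (key y).2 (hy.1 F hF hvan)

theorem mul_eq_mul_of_mem_extendedLikelihoodCorrespondence {x : Fin 3 → PSpace n}
    (hx : x ∈ extendedLikelihoodCorrespondence X) (i j : Fin (n + 2)) :
    (x 0).rep i * (x 1).rep i * (x 2).rep j = (x 0).rep j * (x 1).rep j * (x 2).rep i := by
  have hhom (i j : Fin (n + 2)) : IsWeightedHomogeneous
      (fun ji : Fin 3 × Fin (n + 2) => (Pi.single ji.1 1 : Fin 3 → ℕ))
      (MvPolynomial.X (0, i) * MvPolynomial.X (1, i) * MvPolynomial.X (2, j) :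
        MvPolynomial (Fin 3 × Fin (n + 2)) ℂ)
      (Pi.single 0 1 + Pi.single 1 1 + Pi.single 2 1) :=
    ((isWeightedHomogeneous_X ℂ _ (0, i)).mul (isWeightedHomogeneous_X ℂ _ (1, i))).mul
      (isWeightedHomogeneous_X ℂ _ (2, j))
  have h := hx (MvPolynomial.X (0, i) * MvPolynomial.X (1, i) * MvPolynomial.X (2, j) -
      MvPolynomial.X (0, j) * MvPolynomial.X (1, j) * MvPolynomial.X (2, i))
    (isMultihomogeneous_of_isWeightedHomogeneous
      (Submodule.sub_mem (weightedHomogeneousSubmodule ℂ _ _) (hhom i j) (hhom j i)))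
    (fun y hy => by
      obtain ⟨hne, hy2⟩ := hy.2
      obtain ⟨a, ha⟩ := Projectivization.exists_smul_eq_mk_rep ℂ _ hne
      have hrep (l) : (y 2).rep l = a * ((y 0).rep l * (y 1).rep l) := by
        rw [← hy2, ← ha]
        rfl
      simp only [MultiVanishes, map_sub, map_mul, eval_X, hrep]
      ring)
  simpa [MultiVanishes, sub_eq_zero] using h

/-- The equations alone would allow p*b = 0; off 𝓗 this cannot happen, since b has a nonzero
coordinate. -/
theorem isCoordProduct_of_mul_eq_mul {p b u : PSpace n} (hp : p ∉ coordHyperplanes n)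
    (h : ∀ i j, p.rep i * b.rep i * u.rep j = p.rep j * b.rep j * u.rep i) :
    IsCoordProduct p b u := by
  have hp' (i) : p.rep i ≠ 0 := fun h0 => hp (Finset.prod_eq_zero (Finset.mem_univ i) h0)
  obtain ⟨i, hi⟩ := Function.ne_iff.1 b.rep_nonzero
  have hpb : p.rep i * b.rep i ≠ 0 := mul_ne_zero (hp' i) hi
  have hui : u.rep i ≠ 0 := by
    intro h0
    refine u.rep_nonzero (funext fun j => ?_)
    have := h i j
    rw [h0, mul_zero] at this
    exact (mul_eq_zero.1 this).resolve_left hpb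
  have hne : (fun i => p.rep i * b.rep i) ≠ 0 := fun h0 => hpb (congrFun h0 i)
  refine ⟨hne, ?_⟩
  conv_rhs => rw [← u.mk_rep]
  rw [Projectivization.mk_eq_mk_iff']
  refine ⟨p.rep i * b.rep i / u.rep i, funext fun j => ?_⟩
  rw [Pi.smul_apply, smul_eq_mul, div_mul_eq_mul_div, h i j, mul_div_cancel_right₀ _ hui]

end Correspondence

end MLDataSingular

theorem theorem1p1 (n : ℕ) (X : Set (MLDataSingular.PSpace n))
    (hX : MLDataSingular.IsAlgebraicStatisticalModel X) :
    MLDataSingular.hadamardProduct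
        (MLDataSingular.singularLocus X \ MLDataSingular.coordHyperplanes n)
        {MLDataSingular.onesPoint n} ⊆ MLDataSingular.dataSingularLocus X ∧
      MLDataSingular.dataSingularLocus X ⊆
        MLDataSingular.hadamardProduct
          (MLDataSingular.singularLocus X \ MLDataSingular.coordHyperplanes n)
          (MLDataSingular.dualVariety X) := by
  constructor
  · rintro u ⟨p, hp, b, rfl, -, hu⟩
    exact ⟨![p, MLDataSingular.onesPoint n, u], ⟨hp, MLDataSingular.subset_zariskiClosure _
      ⟨MLDataSingular.mem_conormalVariety_onesPoint hX hp.1.1, hu⟩⟩, rfl⟩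
  · rintro _ ⟨x, ⟨hp, hx⟩, rfl⟩
    have hcon :=
      MLDataSingular.mem_conormalVariety_of_mem_extendedLikelihoodCorrespondence hx
    exact ⟨x 0, hp, x 1, ⟨_, hcon, rfl⟩,
      MLDataSingular.sum_eq_zero_of_mem_conormalVariety hcon,
      MLDataSingular.isCoordProduct_of_mul_eq_mul hp.2
        (MLDataSingular.mul_eq_mul_of_mem_extendedLikelihoodCorrespondence hx)⟩
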